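/- For $n\ge 1$ let $[n]=\{1,\dots,n\}$. A restriction $\alpha|_X$ of a map $\alpha:[n]\to[n]$ to $X\subseteq[n]$ is called even if the number of pairs $a<b$ in $X$ with $a\alpha>b\alpha$ is even, and the rank of $\alpha$ is the size of its image. Let $\Gamma_n$ be the set of permutations of $[n]$ all of whose restrictions to $(n-1)$-element subsets of $[n]$ are even; let $\Sigma_n$ be the set of transformations of $[n]$ all of whose injective restrictions to $(n-1)$-element subsets are even; let $\Delta_n$ be the submonoid of the monoid of all transformations of $[n]$ generated by the elements of $\Sigma_n$ of rank at least $n-1$; and let $\Sigma_n(\mathbf r=n-1)$ be the set of elements of $\Sigma_n$ of rank $n-1$. Let $S(a,b)$ denote the Stirling number of the second kind, with $S(a,b)=0$ for $b<0$. Then, for every $n\ge 3$, $$|\Sigma_n| = n^n-\Bigl(1+\binom n2\Bigr)n!+|\Gamma_n|+|\Sigma_n(\mathbf r=n-1)|,$$ where $$|\Gamma_n|=\begin{cases}\frac12\left(\frac{n-1}2\right)!\left(\frac{n+1}2\right)! & n\text{ odd}\\[2pt] \left(\frac n2\right)!^2 & n\text{ even,}\end{cases}\qquad |\Sigma_n(\mathbf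 r=n-1)|=\begin{cases}\frac{n!\,(n-1)(n+1)}8 & n\text{ odd}\\[2pt] \frac{n!\,n^2}8 & n\text{ even,}\end{cases}$$ so that $$|\Sigma_n|=\begin{cases}n^n-\bigl(1+\binom n2\bigr)n!+\frac12\left(\frac{n-1}2\right)!\left(\frac{n+1}2\right)!+\frac{n!\,(n-1)(n+1)}8 & n\text{ odd}\\[2pt] n^n-\bigl(1+\binom n2\bigr)n!+\left(\frac n2\right)!^2+\frac{n!\,n^2}8 & n\text{ even.}\end{cases}$$ Moreover, $$|\Sigma_n\setminus\Delta_n|=\begin{cases}\displaystyle\sum_{r=1}^{n-2}\binom nr r!\sum_{s=1}^{\frac{n+1}2}S\left(\tfrac{n+1}2,s\right)S\left(\tfrac{n-1}2,r-s\right) & n\text{ odd}\\[4pt] \displaystyle\sum_{r=1}^{n-2}\binom nr r!\sum_{s=1}^{\frac n2}S\left(\tfrac n2,s\right)S\left(\tfrac n2,r-s\right) & n\text{ even,}\end{cases}$$ and $|\Delta_n|=|\Sigma_n|-|\Sigma_n\setminus\Delta_n|$, which together with the preceding formulas gives $|\Delta_n|$ explicitly. -/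

import Mathlib

open scoped Nat

namespace EvenTransf

variable {n : ℕ}

/-- The set of inversions of the restriction `α|_X`: pairs `a < b` of elements of `X`
with `α a > α b`. The chain `{1 < ⋯ < n}` is modelled by `Fin n`. -/
def invOn (α : Fin n → Fin n) (X : Finset (Fin n)) : Finset (Fin n × Fin n) :=
  Finset.univ.filter fun p => p.1 ∈ X ∧ p.2 ∈ X ∧ p.1 < p.2 ∧ α p.2 < α p.1

/-- The restriction `α|_X` is even: it has an even number of inversions. -/
def EvenOn (α : Fin n → Fin n) (X : Finset (Fin n)) : Prop :=
  Even (invOn α X).card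

/-- The rank of a transformation: the size of its image. -/
noncomputable def rank (α : Function.End (Fin n)) : ℕ := (Set.range (α : Fin n → Fin n)).ncard

/-- The permutations all of whose restrictions of width `t` are even. -/
def GammaT (n t : ℕ) : Set (Equiv.Perm (Fin n)) :=
  {σ | ∀ X : Finset (Fin n), X.card = t → EvenOn σ X}

/-- The transformations all of whose injective restrictions of width `t` are even. -/
def SigmaT (n t : ℕ) : Set (Function.End (Fin n)) :=
  {α | ∀ X : Finset (Fin n), X.card = t → Set.InjOn (α : Fin n → Fin n) X → EvenOn α X}

/-- The submonoid of the full transformation monoid generated by the elements of `SigmaT n t`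
of rank at least `n - 1`. -/
def DeltaT (n t : ℕ) : Submonoid (Function.End (Fin n)) :=
  Submonoid.closure {α | α ∈ SigmaT n t ∧ n - 1 ≤ rank α}

/-- `Γ_n`, the case of width `n - 1`. -/
def Gamma (n : ℕ) : Set (Equiv.Perm (Fin n)) := GammaT n (n - 1)

/-- `Σ_n`, the case of width `n - 1`. -/
def Sig (n : ℕ) : Set (Function.End (Fin n)) := SigmaT n (n - 1)

/-- `Δ_n`, the case of width `n - 1`. -/
def Delta (n : ℕ) : Submonoid (Function.End (Fin n)) := DeltaT n (n - 1)

/-- `Σ_n(r = k)`: the elements of `Σ_n` of rank `k`. -/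
def SigRank (n k : ℕ) : Set (Function.End (Fin n)) := {α | α ∈ Sig n ∧ rank α = k}

/-- Stirling numbers of the second kind with integer lower index, zero if that is negative. -/
def stirling (a : ℕ) (b : ℤ) : ℕ := if 0 ≤ b then Nat.stirlingSecond a b.toNat else 0

end EvenTransf

/-!
The proof replaces inversions by signs. Call `(-1) ^ i` the parity of the point `i`. If `σ` is a
permutation and `j` a point, the number of inversions of `σ` in which `j` takes part has the parity
of `j + σ j`, so `σ` is even off `j` if and only if `sign σ = parity j * parity (σ j)`
(`evenOn_compl_singleton_iff`). An injective restriction of a map to `n - 1` points always extends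
to a permutation, hence membership in `Sig n` is a condition on the signs of these extensions
(`mem_Sig_iff`), and it follows at once that `Sig n` is closed under products.

* A permutation lies in `Gamma n` if and only if `sign σ = parity j * parity (σ j)` for all `j`: it
  is even and preserves parity, or odd and reverses parity. Parity can be reversed only if `n` is even,
  and half of the parity-preserving permutations have a given sign.
* The maps of rank `n - 1` are the maps `collapse σ i j` with `i ≠ j`. Such a map has two injective
  restrictions to `n - 1` points, extending to `σ` and `σ * swap i j`; so it lies in `Sig n` if and
  only if `i` and `j` have different parities and `σ` satisfies one sign condition
  (`collapse_mem_Sig_iff`).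
* Maps of rank at most `n - 2` have no injective restriction to `n - 1` points and lie in `Sig n`.

Together with the number `n.descFactorial r * S(n, r)` of maps of rank `r`, this gives the size of
`Sig n`.

A map of rank at most `n - 2` lies in `Delta n` if and only if it identifies two points of different
parities (`mem_Sig_sdiff_Delta_iff`). The condition is necessary because generators of rank `n - 1`
identify such points and the elements of `Gamma n` preserve or reverse parity. It is sufficient by
induction on `n - rank f`: if `f i = f j` with `i`, `j` of different parities, then `f` also
identifies two points `a`, `b` other than `j`, and `f = g * collapse σ i j` where `σ` carries `a`,
`b` to two points of different parities, which `g` identifies, and the value of `g` at `σ j`, which is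
free, is chosen outside the range of `f`. The rank of `g` is larger by one, and the remaining
freedom in `σ` makes both factors even (`mem_Delta_of_factor`, `mem_Delta_of_identifies_of_four_le`).
This needs four points; for `n = 3` only constant maps remain (`const_mem_Delta_three`).

So `Sig n \ Delta n` consists of the maps of rank at most `n - 2` that take disjoint sets of values
on the two parity classes; choosing the values first on one class and then on the other yields the sums
over products of Stirling numbers (`ncard_ker_le_parity_rank_eq`).
-/

namespace EvenTransf

open Finset Equiv

variable {n : ℕ}

/-! ### Inversions and signs -/

/-- The parity of a point, as a sign. Points are numbered from `0`, so `parity i = 1` singles out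
the odd elements of the chain `1 < ⋯ < n`. -/
def parity (i : Fin n) : ℤˣ := (-1) ^ (i : ℕ)

lemma eq_neg_of_ne {a b : ℤˣ} (h : a ≠ b) : a = -b := by
  rcases Int.units_eq_one_or a with rfl | rfl <;> rcases Int.units_eq_one_or b with rfl | rfl <;>
    simp_all

lemma parity_mul_self (i : Fin n) : parity i * parity i = 1 := Int.units_mul_self _

lemma neg_one_pow_card_invOn_univ (σ : Perm (Fin n)) :
    (-1 : ℤˣ) ^ (invOn σ univ).card = Perm.sign σ := by
  rw [Perm.sign_eq_prod_prod_Ioi, invOn, ← prod_const, prod_filter, Fintype.prod_prod_type]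
  refine prod_congr rfl fun i _ => ?_
  rw [← prod_subset (subset_univ (Ioi i))]
  · refine prod_congr rfl fun j hj => ?_
    have hij : i < j := mem_Ioi.1 hj
    have hne : σ i ≠ σ j := fun h => hij.ne (σ.injective h)
    rcases lt_or_gt_of_ne hne with h | h
    · simp [h, not_lt.2 h.le]
    · simp [h, hij, not_lt.2 h.le]
  · intro j _ hj
    have hij : ¬ i < j := fun h => hj (mem_Ioi.2 h)
    simp [hij]

/-- Deleting the point `j` from a permutation removes the inversions in which `j` takes part,
and their number has the parity of `j + σ j`. -/
lemma neg_one_pow_card_invOn_compl (σ : Perm (Fin n)) (j : Fin n) :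
    (-1 : ℤˣ) ^ (invOn σ {j}ᶜ).card = Perm.sign σ * (parity j * parity (σ j)) := by
  -- `j` takes part in `#a + #b` inversions, and `#a + #c = j`, `#b + #c = σ j`
  set a := univ.filter fun i => i < j ∧ σ j < σ i with ha
  set b := univ.filter fun i => j < i ∧ σ i < σ j with hb
  set c := univ.filter fun i => i < j ∧ σ i < σ j with hc
  have hac : a.card + c.card = j := by
    rw [← card_union_of_disjoint, ← Fin.card_Iio j]
    · congr 1
      ext i
      simp only [ha, hc, mem_union, mem_filter, mem_univ, true_and, mem_Iio]
      constructor
      · tauto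
      · intro h
        rcases lt_or_gt_of_ne fun e => h.ne (σ.injective e) with h' | h' <;> tauto
    · rw [disjoint_left]
      intro i hi hi'
      simp only [ha, hc, mem_filter, mem_univ, true_and] at hi hi'
      exact absurd hi.2 (not_lt.2 hi'.2.le)
  have hbc : b.card + c.card = σ j := by
    rw [← card_union_of_disjoint, ← Fin.card_Iio (σ j),
      ← card_map (s := Iio (σ j)) σ.symm.toEmbedding]
    · congr 1
      ext i
      simp only [hb, hc, mem_union, mem_filter, mem_univ, true_and, mem_map_equiv, mem_Iio,
        symm_symm]
      constructor
      · tauto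
      · intro h
        rcases lt_or_gt_of_ne fun e : i = j => h.ne (congrArg σ e) with h' | h' <;> tauto
    · rw [disjoint_left]
      intro i hi hi'
      simp only [hb, hc, mem_filter, mem_univ, true_and] at hi hi'
      exact absurd hi.1 (not_lt.2 hi'.1.le)
  have hsplit : (invOn σ univ).card = (invOn σ {j}ᶜ).card + a.card + b.card := by
    have : invOn σ univ = (invOn σ {j}ᶜ ∪ a.image (fun i => (i, j))) ∪
        b.image (fun i => (j, i)) := by
      ext ⟨x, y⟩
      simp only [invOn, ha, hb, mem_union, mem_filter, mem_univ, true_and, mem_image,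
        mem_compl, mem_singleton, Prod.mk.injEq]
      constructor
      · rintro ⟨h, h'⟩
        by_cases hy : y = j
        · subst hy; exact Or.inl (Or.inr ⟨x, ⟨h, h'⟩, rfl, rfl⟩)
        by_cases hx : x = j
        · subst hx; exact Or.inr ⟨y, ⟨h, h'⟩, rfl, rfl⟩
        exact Or.inl (Or.inl ⟨hx, hy, h, h'⟩)
      · rintro ((h | ⟨i, h, rfl, rfl⟩) | ⟨i, h, rfl, rfl⟩) <;> tauto
    rw [this, card_union_of_disjoint, card_union_of_disjoint,
      card_image_of_injective _ fun x y h => (Prod.mk.inj h).1,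
      card_image_of_injective _ fun x y h => (Prod.mk.inj h).2]
    · rw [disjoint_left]
      rintro ⟨x, y⟩ h h'
      simp only [invOn, mem_filter, mem_compl, mem_singleton, mem_image,
        Prod.mk.injEq] at h h'
      obtain ⟨i, _, _, e⟩ := h'
      exact h.2.2.1 e.symm
    · rw [disjoint_left]
      rintro ⟨x, y⟩ h h'
      simp only [invOn, ha, mem_union, mem_filter, mem_compl, mem_singleton, mem_image,
        Prod.mk.injEq, mem_univ, true_and, hb] at h h'
      obtain ⟨i, hi, e, e'⟩ := h'
      subst e e'
      rcases h with h | ⟨k, hk, e, e'⟩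
      · exact h.1 rfl
      · exact hi.1.ne' e'.symm
  rw [← neg_one_pow_card_invOn_univ, hsplit, parity, parity, ← hac, ← hbc]
  simp only [pow_add]
  have h1 := Int.units_mul_self ((-1 : ℤˣ) ^ a.card)
  have h2 := Int.units_mul_self ((-1 : ℤˣ) ^ b.card)
  have h3 := Int.units_mul_self ((-1 : ℤˣ) ^ c.card)
  generalize (-1 : ℤˣ) ^ a.card = u at *
  generalize (-1 : ℤˣ) ^ b.card = v at *
  generalize (-1 : ℤˣ) ^ c.card = w at *
  generalize (-1 : ℤˣ) ^ (invOn σ {j}ᶜ).card = z at *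
  calc z = z * (u * u) * (v * v) * (w * w) := by rw [h1, h2, h3]; simp
    _ = _ := by ac_rfl

lemma evenOn_compl_singleton_iff (σ : Perm (Fin n)) (j : Fin n) :
    EvenOn σ {j}ᶜ ↔ Perm.sign σ = parity j * parity (σ j) := by
  rw [EvenOn, ← neg_one_pow_eq_one_iff_even (R := ℤˣ) (by decide), neg_one_pow_card_invOn_compl,
    ← Int.units_inv_eq_self (parity j * parity (σ j)), mul_inv_eq_one, Int.units_inv_eq_self]

lemma evenOn_congr {f g : Fin n → Fin n} {X : Finset (Fin n)} (h : ∀ x ∈ X, f x = g x) :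
    EvenOn f X ↔ EvenOn g X := by
  have : invOn f X = invOn g X := by
    ext p
    simp only [invOn, mem_filter, mem_univ, true_and]
    constructor <;> rintro ⟨h1, h2, h3, h4⟩ <;> refine ⟨h1, h2, h3, ?_⟩
    · rwa [← h _ h1, ← h _ h2]
    · rwa [h _ h1, h _ h2]
  rw [EvenOn, EvenOn, this]

/-- A map that is injective off one point agrees off that point with a permutation. -/
lemma exists_perm_of_injOn {f : Fin n → Fin n} {j : Fin n} (h : Set.InjOn f {j}ᶜ) :
    ∃ σ : Perm (Fin n), ∀ x, x ≠ j → f x = σ x := by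
  -- the extension sends `j` to the value that `f` omits off `j`
  have hcard : (image f ({j}ᶜ : Finset (Fin n))).card < Fintype.card (Fin n) := by
    refine card_image_le.trans_lt ?_
    rw [card_compl, card_singleton]
    have : 0 < Fintype.card (Fin n) := Fintype.card_pos_iff.2 ⟨j⟩
    omega
  obtain ⟨v, hv⟩ : ∃ v, v ∉ image f ({j}ᶜ : Finset (Fin n)) := by
    by_contra! hall
    rw [eq_univ_iff_forall.2 hall, card_univ] at hcard
    exact hcard.false
  have hv' : ∀ x, x ≠ j → f x ≠ v := fun x hx e => hv (mem_image.2 ⟨x, by simpa using hx, e⟩)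
  have hinj : Function.Injective (Function.update f j v) := by
    intro x y hxy
    by_cases hx : x = j <;> by_cases hy : y = j
    · rw [hx, hy]
    · subst hx; rw [Function.update_self, Function.update_of_ne hy] at hxy
      exact absurd hxy.symm (hv' y hy)
    · subst hy; rw [Function.update_self, Function.update_of_ne hx] at hxy
      exact absurd hxy (hv' x hx)
    · rw [Function.update_of_ne hx, Function.update_of_ne hy] at hxy
      exact h hx hy hxy
  refine ⟨Equiv.ofBijective _ (Finite.injective_iff_bijective.1 hinj), fun x hx => ?_⟩
  simp [Function.update_of_ne hx]

lemma injOn_of_perm {f : Fin n → Fin n} {j : Fin n} {σ : Perm (Fin n)}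
    (h : ∀ x, x ≠ j → f x = σ x) : Set.InjOn f {j}ᶜ := by
  intro x hx y hy hxy
  rw [h x hx, h y hy] at hxy
  exact σ.injective hxy

/-- Evenness of all injective restrictions to `n - 1` points, read off the signs of the
permutations that extend these restrictions. -/
lemma mem_Sig_iff {f : Function.End (Fin n)} :
    f ∈ Sig n ↔ ∀ (j : Fin n) (σ : Perm (Fin n)), (∀ x, x ≠ j → f x = σ x) →
      Perm.sign σ = parity j * parity (σ j) := by
  constructor
  · intro h j σ hσ
    rw [← evenOn_compl_singleton_iff, ← evenOn_congr fun x hx => hσ x (by simpa using hx)]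
    refine h _ ?_ ?_
    · rw [card_compl, card_singleton, Fintype.card_fin]
    · simpa using injOn_of_perm hσ
  · intro h X hX hinj
    rcases Nat.eq_zero_or_pos n with rfl | hn
    · simp [EvenOn, invOn]
    have hXc : Xᶜ.card = 1 := by rw [card_compl, hX, Fintype.card_fin]; omega
    obtain ⟨j, hj⟩ := card_eq_one.1 hXc
    obtain rfl : X = {j}ᶜ := by rw [← hj, compl_compl]
    obtain ⟨σ, hσ⟩ := exists_perm_of_injOn (by simpa using hinj)
    rw [evenOn_congr fun x hx => hσ x (by simpa using hx), evenOn_compl_singleton_iff]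
    exact h j σ hσ

lemma perm_eq_of_eq_off {σ τ : Perm (Fin n)} {j : Fin n} (h : ∀ x, x ≠ j → σ x = τ x) :
    σ = τ := by
  have key : τ⁻¹ (σ j) = j := by
    by_contra hne
    have := h _ hne
    rw [← Perm.mul_apply τ, mul_inv_cancel, Perm.one_apply] at this
    exact hne (σ.injective this)
  ext1 x
  by_cases hx : x = j
  · subst hx; rw [Perm.inv_eq_iff_eq] at key; exact key
  · exact h x hx

/-- A permutation as a transformation. -/
def ofPerm (σ : Perm (Fin n)) : Function.End (Fin n) := (σ : Fin n → Fin n)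

lemma ofPerm_mem_Sig_iff {σ : Perm (Fin n)} :
    ofPerm σ ∈ Sig n ↔ ∀ j, Perm.sign σ = parity j * parity (σ j) := by
  rw [mem_Sig_iff]
  exact ⟨fun h j => h j σ fun _ _ => rfl, fun h j τ hτ => perm_eq_of_eq_off hτ ▸ h j⟩

lemma mem_Gamma_iff {σ : Perm (Fin n)} :
    σ ∈ Gamma n ↔ ∀ j, Perm.sign σ = parity j * parity (σ j) := by
  rw [← ofPerm_mem_Sig_iff]
  exact ⟨fun h X hX _ => h X hX, fun h X hX => h X hX σ.injective.injOn⟩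

/-- The map that agrees with `σ` off `j` and identifies `j` with `i`. For `i ≠ j` these are the maps
of rank `n - 1`. -/
def collapse (σ : Perm (Fin n)) (i j : Fin n) : Function.End (Fin n) :=
  Function.update σ j (σ i)

lemma collapse_of_ne (σ : Perm (Fin n)) (i : Fin n) {j x : Fin n} (hx : x ≠ j) :
    collapse σ i j x = σ x := Function.update_of_ne hx _ _

lemma collapse_self (σ : Perm (Fin n)) (i j : Fin n) : collapse σ i j j = σ i :=
  Function.update_self _ _ _

lemma collapse_left (σ : Perm (Fin n)) (i j : Fin n) : collapse σ i j i = σ i := by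
  by_cases h : i = j
  · subst h; exact collapse_self _ _ _
  · exact collapse_of_ne _ _ h

lemma eq_collapse {f : Function.End (Fin n)} {σ : Perm (Fin n)} {i j : Fin n} (hij : i ≠ j)
    (h : ∀ x, x ≠ j → f x = σ x) (hf : f i = f j) : f = collapse σ i j := by
  funext x
  by_cases hx : x = j
  · subst hx; rw [collapse_self, ← hf, h i hij]
  · rw [collapse_of_ne _ _ hx, h x hx]

/-- The two injective restrictions of `collapse σ i j` to `n - 1` points extend to `σ` and to
`σ * swap i j`, which have opposite signs; so they can both be even only if the parities of `i` and
`j` differ. -/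
lemma collapse_mem_Sig_iff {σ : Perm (Fin n)} {i j : Fin n} (hij : i ≠ j) :
    collapse σ i j ∈ Sig n ↔
      parity i ≠ parity j ∧ Perm.sign σ = parity j * parity (σ j) := by
  have hswap : ∀ x, x ≠ i → collapse σ i j x = (σ * swap i j) x := by
    intro x hx
    by_cases hxj : x = j
    · subst hxj; rw [collapse_self, Perm.mul_apply, swap_apply_right]
    · rw [collapse_of_ne _ _ hxj, Perm.mul_apply, swap_apply_of_ne_of_ne hx hxj]
  rw [mem_Sig_iff]
  constructor
  · intro h
    have h1 := h j σ fun x hx => collapse_of_ne σ i hx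
    have h2 := h i _ hswap
    rw [Perm.sign_mul, Perm.sign_swap hij, Perm.mul_apply, swap_apply_left, h1] at h2
    refine ⟨fun e => ?_, h1⟩
    rw [e] at h2
    rw [mul_neg_one] at h2
    exact units_ne_neg_self _ h2.symm
  · rintro ⟨hp, h⟩ k τ hτ
    have hk : k = i ∨ k = j := by
      by_contra! hk
      have := injOn_of_perm hτ (Ne.symm hk.1) (Ne.symm hk.2)
        (show collapse σ i j i = collapse σ i j j by rw [collapse_left, collapse_self])
      exact hij this
    rcases hk with rfl | rfl
    · obtain rfl : τ = σ * swap k j :=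
        perm_eq_of_eq_off (j := k) fun x hx => (hτ x hx).symm.trans (hswap x hx)
      rw [Perm.sign_mul, Perm.sign_swap hij, Perm.mul_apply, swap_apply_left, h, eq_neg_of_ne hp]
      simp
    · obtain rfl : τ = σ :=
        perm_eq_of_eq_off (j := k) fun x hx => (hτ x hx).symm.trans (collapse_of_ne σ i hx)
      exact h

lemma perm_inv_apply_self (σ : Perm (Fin n)) (x : Fin n) : σ⁻¹ (σ x) = x := σ.symm_apply_apply x

/-! ### Rank -/

lemma rank_eq_card_image (f : Fin n → Fin n) : rank f = (univ.image f).card := by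
  change (Set.range f).ncard = _
  rw [← Set.ncard_coe_finset, coe_image, coe_univ, Set.image_univ]

lemma rank_le (f : Fin n → Fin n) : rank f ≤ n := by
  rw [rank_eq_card_image]
  exact card_image_le.trans_eq (by simp)

lemma rank_eq_iff_injective {f : Fin n → Fin n} : rank f = n ↔ Function.Injective f := by
  rw [rank_eq_card_image, ← Set.injOn_univ, ← coe_univ, ← card_image_iff, card_univ,
    Fintype.card_fin]

lemma sub_one_le_rank {f : Fin n → Fin n} {σ : Perm (Fin n)} {j : Fin n}
    (h : ∀ x, x ≠ j → f x = σ x) : n - 1 ≤ rank f := by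
  rw [rank_eq_card_image]
  have hc : (({j}ᶜ : Finset (Fin n)).image f).card = n - 1 := by
    rw [card_image_of_injOn (by simpa using injOn_of_perm h), card_compl, card_singleton,
      Fintype.card_fin]
  exact hc ▸ card_le_card (image_subset_image (subset_univ _))

lemma rank_collapse (σ : Perm (Fin n)) {i j : Fin n} (hij : i ≠ j) :
    rank (collapse σ i j) = n - 1 := by
  have h1 : n - 1 ≤ rank (collapse σ i j) := sub_one_le_rank fun x hx => collapse_of_ne σ i hx
  have h2 : rank (collapse σ i j) ≠ n := fun h =>
    hij (rank_eq_iff_injective.1 h (by rw [collapse_left, collapse_self]))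
  have h3 := rank_le (collapse σ i j)
  omega

lemma exists_eq_collapse {f : Fin n → Fin n} (hr : rank f = n - 1) {i j : Fin n}
    (hij : i ≠ j) (hf : f i = f j) : ∃ σ, f = collapse σ i j := by
  have himg : univ.image f = ({j}ᶜ : Finset (Fin n)).image f := by
    ext y
    simp only [mem_image, mem_univ, true_and, mem_compl, mem_singleton]
    constructor
    · rintro ⟨x, rfl⟩
      by_cases hx : x = j
      · exact ⟨i, hij, hf.trans (by rw [hx])⟩
      · exact ⟨x, hx, rfl⟩
    · rintro ⟨x, _, rfl⟩
      exact ⟨x, rfl⟩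
  have hinj : Set.InjOn f (({j}ᶜ : Finset (Fin n)) : Set (Fin n)) := by
    rw [← card_image_iff, ← himg, ← rank_eq_card_image, hr, card_compl, card_singleton,
      Fintype.card_fin]
  obtain ⟨σ, hσ⟩ := exists_perm_of_injOn (by simpa using hinj)
  exact ⟨σ, eq_collapse hij hσ hf⟩

lemma exists_ne_eq_of_rank_lt {f : Function.End (Fin n)} (h : rank f < n) :
    ∃ i j, i ≠ j ∧ f i = f j := by
  by_contra! hall
  exact h.ne (rank_eq_iff_injective.2 fun i j hij => by_contra fun hne => hall i j hne hij)

/-- A map of rank at most `n - 2` has no injective restriction to `n - 1` points. -/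
lemma mem_Sig_of_rank_lt {f : Function.End (Fin n)} (h : rank f < n - 1) : f ∈ Sig n :=
  mem_Sig_iff.2 fun _ _ hσ => absurd (sub_one_le_rank hσ) (not_le.2 h)

/-! ### The monoid generated by the even maps of large rank -/

lemma mem_Delta_of_rank {f : Function.End (Fin n)} (hf : f ∈ Sig n) (hr : n - 1 ≤ rank f) :
    f ∈ Delta n := Submonoid.subset_closure ⟨hf, hr⟩

lemma one_mem_Sig : (1 : Function.End (Fin n)) ∈ Sig n :=
  ofPerm_mem_Sig_iff (σ := 1).2 fun j => by simp

lemma mul_mem_Sig {f g : Function.End (Fin n)} (hf : f ∈ Sig n) (hg : g ∈ Sig n) :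
    f * g ∈ Sig n := by
  rw [mem_Sig_iff] at *
  intro j π hπ
  -- `g` is injective off `j`, hence extends to a permutation `σ`, and `f` extends to `π * σ⁻¹`
  have hinj : Set.InjOn g {j}ᶜ := fun x hx y hy hxy => by
    refine injOn_of_perm hπ hx hy ?_
    change f (g x) = f (g y)
    rw [hxy]
  obtain ⟨σ, hσ⟩ := exists_perm_of_injOn hinj
  have h1 := hg j σ hσ
  have h2 := hf (σ j) (π * σ⁻¹) (by
    intro y hy
    obtain ⟨x, rfl⟩ := σ.surjective y
    have hx : x ≠ j := fun e => hy (e ▸ rfl)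
    rw [← hσ x hx]
    change (f * g) x = _
    rw [hπ x hx, hσ x hx, Perm.mul_apply, perm_inv_apply_self])
  rw [Perm.mul_apply, perm_inv_apply_self, Perm.sign_mul, Perm.sign_inv, h1] at h2
  calc Perm.sign π = Perm.sign π * (parity j * parity (σ j)) * (parity j * parity (σ j)) := by
        rw [mul_assoc, Int.units_mul_self, mul_one]
    _ = parity j * parity (π j) * (parity (σ j) * parity (σ j)) := by rw [h2]; ac_rfl
    _ = _ := by rw [parity_mul_self, mul_one]

/-- A product of generators is injective or identifies two points of opposite parity, because the
injective generators respect the relation of having opposite parities. -/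
lemma mem_Sig_and_of_mem_Delta {f : Function.End (Fin n)} (hf : f ∈ Delta n) :
    f ∈ Sig n ∧ (Function.Injective f ∨ ∃ i j, parity i ≠ parity j ∧ f i = f j) := by
  induction hf using Submonoid.closure_induction with
  | mem f hf =>
    refine ⟨hf.1, ?_⟩
    by_cases h : rank f = n
    · exact Or.inl (rank_eq_iff_injective.1 h)
    have hle := rank_le f
    have hge : n - 1 ≤ rank f := hf.2
    obtain ⟨i, j, hij, he⟩ := exists_ne_eq_of_rank_lt (lt_of_le_of_ne hle h)
    obtain ⟨σ, rfl⟩ := exists_eq_collapse (by omega) hij he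
    exact Or.inr ⟨i, j, ((collapse_mem_Sig_iff hij).1 hf.1).1, he⟩
  | one => exact ⟨one_mem_Sig, Or.inl fun _ _ h => h⟩
  | mul f g _ _ hf hg =>
    refine ⟨mul_mem_Sig hf.1 hg.1, ?_⟩
    rcases hg.2 with hgi | ⟨i, j, hij, he⟩
    · rcases hf.2 with hfi | ⟨i, j, hij, he⟩
      · exact Or.inl (hfi.comp hgi)
      · right
        set σ : Perm (Fin n) := Equiv.ofBijective g (Finite.injective_iff_bijective.1 hgi)
        have hσ : ∀ k, Perm.sign σ = parity k * parity (σ k) := ofPerm_mem_Sig_iff.1 hg.1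
        obtain ⟨i, rfl⟩ := σ.surjective i
        obtain ⟨j, rfl⟩ := σ.surjective j
        refine ⟨i, j, fun e => hij ?_, he⟩
        have := (hσ i).symm.trans (hσ j)
        rw [e] at this
        exact mul_left_cancel this
    · refine Or.inr ⟨i, j, hij, ?_⟩
      change f (g i) = f (g j)
      rw [he]

lemma exists_perm_apply_eq {a b p q : Fin n} (hab : a ≠ b) (hpq : p ≠ q) :
    ∃ σ : Perm (Fin n), σ a = p ∧ σ b = q := by
  refine ⟨swap (swap a p b) q * swap a p, ?_, ?_⟩
  · rw [Perm.mul_apply, swap_apply_left, swap_apply_of_ne_of_ne _ hpq]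
    intro h
    have := (swap a p).injective ((swap_apply_left a p).trans h)
    exact hab this
  · rw [Perm.mul_apply, swap_apply_left]

/-- A right factor `collapse σ i j` of `f` can be made even without changing the left factor `g`,
by exchanging two values that `g` identifies. -/
lemma mem_Delta_of_factor {f g : Function.End (Fin n)} {σ : Perm (Fin n)} {i j p q : Fin n}
    (hij : parity i ≠ parity j) (hf : f i = f j) (hpq : p ≠ q) (hg : g p = g q)
    (hp : σ j ≠ p) (hq : σ j ≠ q) (hgf : ∀ x, x ≠ j → g (σ x) = f x) (hgD : g ∈ Delta n) :
    f ∈ Delta n := by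
  have hne : i ≠ j := fun e => hij (e ▸ rfl)
  have key : ∀ τ : Perm (Fin n), (∀ x, x ≠ j → g (τ x) = f x) →
      Perm.sign τ = parity j * parity (τ j) → f ∈ Delta n := by
    intro τ hτ hs
    have hfac : f = g * collapse τ i j := by
      funext x
      change f x = g (collapse τ i j x)
      by_cases hx : x = j
      · subst hx; rw [collapse_self, hτ i hne, hf]
      · rw [collapse_of_ne _ _ hx, hτ x hx]
    rw [hfac]
    exact mul_mem hgD (mem_Delta_of_rank ((collapse_mem_Sig_iff hne).2 ⟨hij, hs⟩)
      (rank_collapse τ hne).ge)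
  by_cases hs : Perm.sign σ = parity j * parity (σ j)
  · exact key σ hgf hs
  · refine key (swap p q * σ) (fun x hx => ?_) ?_
    · rw [Perm.mul_apply, ← hgf x hx]
      rcases eq_or_ne (σ x) p with h | h
      · rw [h, swap_apply_left, hg]
      rcases eq_or_ne (σ x) q with h' | h'
      · rw [h', swap_apply_right, hg]
      rw [swap_apply_of_ne_of_ne h h']
    · rw [Perm.sign_mul, Perm.sign_swap hpq, Perm.mul_apply, swap_apply_of_ne_of_ne hp hq,
        eq_neg_of_ne hs]
      simp

/-- Peel off one even right factor of rank `n - 1`, leaving a left factor `g` whose rank is larger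
by one and which still identifies two points `0` and `1` of opposite parity. Once `g` has rank
`n - 1` it has to be even; if it is not, exchanging its arguments `2` and `3` makes it so. -/
lemma mem_Delta_of_identifies_of_four_le (hn : 4 ≤ n) (d : ℕ) :
    ∀ {f : Function.End (Fin n)} {i j : Fin n}, rank f + d + 2 = n → parity i ≠ parity j →
      f i = f j → f ∈ Delta n := by
  induction d with
  | zero => ?_
  | succ d ih => ?_
  all_goals
    intro f i j hd hij hf
    -- `f` has at most `n - 2` values on the `n - 1` points other than `j`
    obtain ⟨a, b, haj, hbj, hab, hfab⟩ :
        ∃ a b, a ≠ j ∧ b ≠ j ∧ a ≠ b ∧ f a = f b := by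
      by_contra! h
      obtain ⟨σ, hσ⟩ := exists_perm_of_injOn (f := f) (j := j)
        fun x hx y hy hxy => by_contra fun hne => h x y hx hy hne hxy
      have := sub_one_le_rank hσ
      omega
    obtain ⟨w, hw⟩ : ∃ w, w ∉ Set.range f := by
      by_contra! h
      have : rank f = n := rank_eq_iff_injective.2 (Finite.injective_iff_surjective.2 h)
      omega
    have hne : i ≠ j := fun e => hij (e ▸ rfl)
    set p : Fin n := ⟨0, by omega⟩ with hp
    set q : Fin n := ⟨1, by omega⟩ with hq
    have hpq : p ≠ q := by simp [hp, hq]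
    have hpar : parity p ≠ parity q := by simp only [parity, hp, hq]; decide
    obtain ⟨σ, hσa, hσb⟩ := exists_perm_apply_eq hab hpq
    have hjp : σ j ≠ p := fun e => haj (σ.injective (hσa.trans e.symm))
    have hjq : σ j ≠ q := fun e => hbj (σ.injective (hσb.trans e.symm))
    -- `g * collapse σ i j` does not depend on the value of `g` at `σ j`
    set g : Function.End (Fin n) := Function.update (fun y => f (σ⁻¹ y)) (σ j) w with hg
    have hgσ : ∀ x, x ≠ j → g (σ x) = f x := fun x hx => by
      rw [hg, Function.update_of_ne (fun e => hx (σ.injective e)), perm_inv_apply_self]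
    have hgj : g (σ j) = w := Function.update_self _ _ _
    have hgpq : g p = g q := by rw [← hσa, ← hσb, hgσ a haj, hgσ b hbj, hfab]
    have hgr : rank g = rank f + 1 := by
      rw [rank, rank, ← Set.ncard_insert_of_notMem hw]
      congr 1
      ext y
      simp only [Set.mem_insert_iff]
      constructor
      · rintro ⟨x, rfl⟩
        obtain ⟨x, rfl⟩ := σ.surjective x
        by_cases hx : x = j
        · left; rw [hx, hgj]
        · right; exact ⟨x, (hgσ x hx).symm⟩
      · rintro (rfl | ⟨x, rfl⟩)
        · exact ⟨σ j, hgj⟩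
        · by_cases hx : x = j
          · exact ⟨σ i, by rw [hgσ i hne, hx, hf]⟩
          · exact ⟨σ x, hgσ x hx⟩
  · obtain ⟨τ, hτ⟩ := exists_eq_collapse (f := g) (by omega) hpq hgpq
    by_cases hs : Perm.sign τ = parity q * parity (τ q)
    · refine mem_Delta_of_factor hij hf hpq hgpq hjp hjq hgσ (mem_Delta_of_rank ?_ (by omega))
      rw [hτ]
      exact (collapse_mem_Sig_iff hpq).2 ⟨hpar, hs⟩
    · set u : Fin n := ⟨2, by omega⟩ with hu
      set v : Fin n := ⟨3, by omega⟩ with hv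
      have huv : u ≠ v := by simp [hu, hv]
      have hsp : swap u v p = p := swap_apply_of_ne_of_ne (by simp [hp, hu]) (by simp [hp, hv])
      have hsq : swap u v q = q := swap_apply_of_ne_of_ne (by simp [hq, hu]) (by simp [hq, hv])
      refine mem_Delta_of_factor (g := collapse (τ * swap u v) p q) (σ := swap u v * σ)
        hij hf hpq ?_ ?_ ?_ ?_ (mem_Delta_of_rank ?_ (rank_collapse _ hpq).ge)
      · rw [collapse_left, collapse_self]
      · intro e
        rw [Perm.mul_apply] at e
        exact hjp ((swap u v).injective (e.trans hsp.symm))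
      · intro e
        rw [Perm.mul_apply] at e
        exact hjq ((swap u v).injective (e.trans hsq.symm))
      · intro x hx
        rw [← hgσ x hx, hτ, Perm.mul_apply]
        by_cases hxq : σ x = q
        · rw [hxq, hsq, collapse_self, collapse_self, Perm.mul_apply, hsp]
        · have hxq' : swap u v (σ x) ≠ q := fun e =>
            hxq ((swap u v).injective (e.trans hsq.symm))
          rw [collapse_of_ne _ _ hxq, collapse_of_ne _ _ hxq', Perm.mul_apply, swap_apply_self]
      · refine (collapse_mem_Sig_iff hpq).2 ⟨hpar, ?_⟩
        rw [Perm.sign_mul, Perm.sign_swap huv, Perm.mul_apply, hsq, eq_neg_of_ne hs]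
        simp
  · exact mem_Delta_of_factor hij hf hpq hgpq hjp hjq hgσ (ih (by omega) hpar hgpq)

/-- On three points the maps in question are constant, and each is a product of two even maps of
rank two. -/
lemma const_mem_Delta_three (c : Fin 3) : (fun _ => c : Function.End (Fin 3)) ∈ Delta 3 := by
  have hcol : ∀ (σ : Perm (Fin 3)) (i j : Fin 3), i ≠ j → parity i ≠ parity j →
      Perm.sign σ = parity j * parity (σ j) → collapse σ i j ∈ Delta 3 := fun σ i j hij hp hs =>
    mem_Delta_of_rank ((collapse_mem_Sig_iff hij).2 ⟨hp, hs⟩) (rank_collapse σ hij).ge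
  have h1 : (fun _ => 0 : Function.End (Fin 3)) = collapse 1 0 1 * collapse (swap 1 2) 0 1 := by
    funext x; revert x; decide
  have h2 : (fun _ => 1 : Function.End (Fin 3)) =
      collapse (swap 0 1) 0 1 * collapse (swap 1 2) 0 1 := by
    funext x; revert x; decide
  have h3 : (fun _ => 2 : Function.End (Fin 3)) = collapse 1 2 1 * collapse (swap 0 1) 0 1 := by
    funext x; revert x; decide
  have h01 : ∀ i j : Fin 3, (i : ℕ) % 2 ≠ (j : ℕ) % 2 → parity i ≠ parity j := by
    unfold parity; decide
  fin_cases c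
  · change (fun _ => 0 : Function.End (Fin 3)) ∈ Delta 3
    rw [h1]
    exact mul_mem (hcol _ _ _ (by decide) (h01 _ _ (by decide)) (by unfold parity; decide))
      (hcol _ _ _ (by decide) (h01 _ _ (by decide)) (by unfold parity; decide))
  · change (fun _ => 1 : Function.End (Fin 3)) ∈ Delta 3
    rw [h2]
    exact mul_mem (hcol _ _ _ (by decide) (h01 _ _ (by decide)) (by unfold parity; decide))
      (hcol _ _ _ (by decide) (h01 _ _ (by decide)) (by unfold parity; decide))
  · change (fun _ => 2 : Function.End (Fin 3)) ∈ Delta 3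
    rw [h3]
    exact mul_mem (hcol _ _ _ (by decide) (h01 _ _ (by decide)) (by unfold parity; decide))
      (hcol _ _ _ (by decide) (h01 _ _ (by decide)) (by unfold parity; decide))

lemma mem_Delta_of_identifies (hn : 3 ≤ n) {f : Function.End (Fin n)} {i j : Fin n}
    (hr : rank f + 2 ≤ n) (hij : parity i ≠ parity j) (hf : f i = f j) : f ∈ Delta n := by
  rcases hn.eq_or_lt with rfl | h4
  · have hc : ∀ x, f x = f 0 := by
      have hr1 : (univ.image f).card ≤ 1 := (rank_eq_card_image f).symm.trans_le (by omega)
      intro x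
      exact card_le_one.1 hr1 _ (mem_image_of_mem _ (mem_univ _)) _
        (mem_image_of_mem _ (mem_univ _))
    have : f = (fun _ => f 0 : Function.End (Fin 3)) := funext hc
    rw [this]
    exact const_mem_Delta_three _
  · exact mem_Delta_of_identifies_of_four_le h4 (n - 2 - rank f) (by omega) hij hf

/-- The elements of `Sig n` outside `Delta n` are the maps of rank at most `n - 2` whose kernel
refines the partition by parity. -/
lemma mem_Sig_sdiff_Delta_iff (hn : 3 ≤ n) {f : Function.End (Fin n)} :
    f ∈ Sig n \ (Delta n : Set (Function.End (Fin n))) ↔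
      rank f + 2 ≤ n ∧ ∀ i j, f i = f j → parity i = parity j := by
  constructor
  · rintro ⟨hS, hD⟩
    have hr : rank f + 2 ≤ n := by
      by_contra hr
      exact hD (mem_Delta_of_rank hS (by omega))
    exact ⟨hr, fun i j he => by_contra fun hij => hD (mem_Delta_of_identifies hn hr hij he)⟩
  · rintro ⟨hr, hker⟩
    refine ⟨mem_Sig_of_rank_lt (by omega), fun hD => ?_⟩
    rcases (mem_Sig_and_of_mem_Delta hD).2 with h | ⟨i, j, hij, he⟩
    · have := rank_eq_iff_injective.2 h
      omega
    · exact hij (hker i j he)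

lemma Delta_subset_Sig : (Delta n : Set (Function.End (Fin n))) ⊆ Sig n :=
  fun _ hf => (mem_Sig_and_of_mem_Delta hf).1

/-! ### Counting maps by rank -/

lemma card_filter_fin_image_eq {B : Type*} [Fintype B] [DecidableEq B] (U : Finset B) (a s : ℕ) :
    (univ.filter fun f : Fin a → B => (∀ x, f x ∈ U) ∧ (univ.image f).card = s).card =
      U.card.descFactorial s * Nat.stirlingSecond a s := by
  induction a generalizing s with
  | zero =>
    rcases s with _ | s
    · simp
    · simp
  | succ a ih =>
    have himg : ∀ (b : B) (g : Fin a → B),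
        univ.image (Fin.cons b g : Fin (a + 1) → B) = insert b (univ.image g) := by
      intro b g
      ext y
      simp [Fin.exists_fin_succ, eq_comm]
    have hU : ∀ (b : B) (g : Fin a → B),
        (∀ x, (Fin.cons b g : Fin (a + 1) → B) x ∈ U) ↔ b ∈ U ∧ ∀ x, g x ∈ U := by
      intro b g
      simp [Fin.forall_fin_succ]
    have hsum : ∀ s, (univ.filter fun f : Fin (a + 1) → B =>
        (∀ x, f x ∈ U) ∧ (univ.image f).card = s).card = ∑ g : Fin a → B,
          (univ.filter fun b : B => (b ∈ U ∧ ∀ x, g x ∈ U) ∧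
            (insert b (univ.image g)).card = s).card := by
      intro s
      simp only [card_filter]
      rw [← (Fin.consEquiv fun _ : Fin (a + 1) => B).sum_comp, Fintype.sum_prod_type_right]
      refine sum_congr rfl fun g _ => sum_congr rfl fun b _ => if_congr ?_ rfl rfl
      rw [← hU b g, ← himg b g]
      rfl
    rw [hsum]
    rcases s with _ | s
    · simp
    -- a first value `b` either repeats one of the `s + 1` values of `g`, or is new
    have hfib : ∀ g : Fin a → B, (univ.filter fun b : B => (b ∈ U ∧ ∀ x, g x ∈ U) ∧
            (insert b (univ.image g)).card = s + 1).card =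
        (if (∀ x, g x ∈ U) ∧ (univ.image g).card = s + 1 then s + 1 else 0) +
          if (∀ x, g x ∈ U) ∧ (univ.image g).card = s then U.card - s else 0 := by
      intro g
      by_cases hg : ∀ x, g x ∈ U
      swap
      · simp [hg]
      have hsub : univ.image g ⊆ U := by
        intro y hy
        obtain ⟨x, _, rfl⟩ := mem_image.1 hy
        exact hg x
      simp only [hg, implies_true, and_true, true_and]
      by_cases h1 : (univ.image g).card = s + 1
      · rw [if_pos h1, if_neg (by omega), add_zero]
        rw [← h1]
        congr 1
        ext b
        simp only [mem_filter, mem_univ, true_and]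
        constructor
        · rintro ⟨_, h⟩
          by_contra hb
          rw [card_insert_of_notMem hb] at h
          omega
        · intro hb
          exact ⟨hsub hb, by rw [insert_eq_of_mem hb]⟩
      rw [if_neg h1, zero_add]
      by_cases h2 : (univ.image g).card = s
      · rw [if_pos h2, ← h2, ← card_sdiff_of_subset hsub]
        congr 1
        ext b
        simp only [mem_filter, mem_univ, true_and, mem_sdiff]
        constructor
        · rintro ⟨hb, h⟩
          refine ⟨hb, fun hb' => ?_⟩
          rw [insert_eq_of_mem hb'] at h
          omega
        · rintro ⟨hb, hb'⟩
          exact ⟨hb, card_insert_of_notMem hb'⟩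
      · rw [if_neg h2, card_eq_zero, filter_eq_empty_iff]
        rintro b - ⟨_, h⟩
        by_cases hb : b ∈ univ.image g
        · rw [insert_eq_of_mem hb] at h; exact h1 h
        · rw [card_insert_of_notMem hb] at h; omega
    rw [sum_congr rfl fun g _ => hfib g, sum_add_distrib, ← sum_filter, ← sum_filter, sum_const,
      sum_const, ih, ih, Nat.stirlingSecond_succ_succ, Nat.descFactorial_succ, smul_eq_mul,
      smul_eq_mul]
    ring

/-- The number of maps from `A` into `U` that take exactly `s` values. -/
lemma card_filter_image_eq {A B : Type*} [Fintype A] [DecidableEq A] [Fintype B] [DecidableEq B]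
    (U : Finset B) (s : ℕ) :
    (univ.filter fun f : A → B => (∀ x, f x ∈ U) ∧ (univ.image f).card = s).card =
      U.card.descFactorial s * Nat.stirlingSecond (Fintype.card A) s := by
  rw [← card_filter_fin_image_eq]
  let e := Fintype.equivFin A
  refine card_bij' (fun f _ => f ∘ e.symm) (fun g _ => g ∘ e) ?_ ?_ ?_ ?_
  · intro f hf
    simp only [mem_filter, mem_univ, true_and, Function.comp_apply] at hf ⊢
    refine ⟨fun x => hf.1 _, ?_⟩
    rw [← image_image, image_univ_equiv, hf.2]
  · intro f hf
    simp only [mem_filter, mem_univ, true_and, Function.comp_apply] at hf ⊢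
    refine ⟨fun x => hf.1 _, ?_⟩
    rw [← image_image, image_univ_equiv, hf.2]
  · intro f _; funext x; simp
  · intro f _; funext x; simp

lemma ncard_rank_eq (n r : ℕ) :
    {f : Function.End (Fin n) | rank f = r}.ncard =
      n.descFactorial r * Nat.stirlingSecond n r := by
  have h := card_filter_image_eq (A := Fin n) (univ : Finset (Fin n)) r
  rw [card_univ, Fintype.card_fin] at h
  rw [← h, ← Set.ncard_coe_finset]
  congr 1
  ext f
  simp only [mem_univ, implies_true, true_and, coe_filter]
  exact ⟨fun h => (rank_eq_card_image f).symm.trans h, fun h => (rank_eq_card_image f).trans h⟩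

lemma ncard_eq_sum_rank (S : Set (Function.End (Fin n))) (I : Finset ℕ)
    (hI : ∀ f ∈ S, rank f ∈ I) : S.ncard = ∑ r ∈ I, {f | f ∈ S ∧ rank f = r}.ncard := by
  classical
  have : Fintype (Function.End (Fin n)) := inferInstanceAs (Fintype (Fin n → Fin n))
  have hS : ∀ T : Set (Function.End (Fin n)), T.ncard = (univ.filter (· ∈ T)).card := by
    intro T
    rw [← Set.ncard_coe_finset]
    congr 1
    ext; simp
  rw [hS, card_eq_sum_card_fiberwise (f := rank) (t := I)]
  · refine sum_congr rfl fun r _ => ?_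
    rw [hS, filter_filter]
    congr 1
    ext f
    simp
  · intro f hf
    exact hI f (by simpa using hf)

/-- The number of points of parity `1`; these are `0, 2, 4, …`. -/
lemma card_parity_eq_one (n : ℕ) :
    (univ.filter fun i : Fin n => parity i = 1).card = (n + 1) / 2 := by
  induction n with
  | zero => rfl
  | succ n ih =>
    rw [card_filter, Fin.sum_univ_castSucc]
    have : ∀ i : Fin n, parity i.castSucc = parity i := fun i => rfl
    simp only [this]
    rw [← card_filter, ih]
    have hlast : parity (Fin.last n) = (-1) ^ n := rfl
    rw [hlast]
    rcases Nat.even_or_odd n with h | h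
    · rw [h.neg_one_pow, if_pos rfl]
      obtain ⟨k, rfl⟩ := h; omega
    · rw [h.neg_one_pow, if_neg (by decide)]
      obtain ⟨k, rfl⟩ := h; omega

lemma card_parity_ne_one (n : ℕ) :
    (univ.filter fun i : Fin n => ¬ parity i = 1).card = n / 2 := by
  have := card_filter_add_card_filter_not (s := univ) fun i : Fin n => parity i = 1
  rw [card_parity_eq_one, card_univ, Fintype.card_fin] at this
  omega

lemma parity_ne_one_iff {i : Fin n} : ¬ parity i = 1 ↔ parity i = -1 :=
  ⟨fun h => (Int.units_eq_one_or _).resolve_left h, fun h => by rw [h]; decide⟩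

lemma rank_eq_add (f : Fin n → Fin n)
    (hdis : ∀ y : {i : Fin n // ¬ parity i = 1},
      f y ∉ univ.image fun x : {i : Fin n // parity i = 1} => f x) :
    rank f = (univ.image fun x : {i : Fin n // parity i = 1} => f x).card +
      (univ.image fun y : {i : Fin n // ¬ parity i = 1} => f y).card := by
  rw [rank_eq_card_image, ← card_union_of_disjoint]
  · congr 1
    ext v
    simp only [mem_image, mem_univ, true_and, mem_union, Subtype.exists, exists_prop]
    constructor
    · rintro ⟨x, rfl⟩
      by_cases hx : parity x = 1
      · exact Or.inl ⟨x, hx, rfl⟩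
      · exact Or.inr ⟨x, hx, rfl⟩
    · rintro (⟨x, _, rfl⟩ | ⟨x, _, rfl⟩) <;> exact ⟨x, rfl⟩
  · rw [disjoint_left]
    intro v hv hv'
    obtain ⟨y, _, rfl⟩ := mem_image.1 hv'
    exact hdis y hv

/-- The points of each parity are mapped independently, except that the values taken on one class
are not available for the other; `s` is the number of values taken on the points of parity `1`. -/
lemma ncard_ker_le_parity_rank_eq (n r : ℕ) :
    {f : Function.End (Fin n) | (∀ i j, f i = f j → parity i = parity j) ∧ rank f = r}.ncard =
      n.descFactorial r * ∑ s ∈ range (r + 1),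
        Nat.stirlingSecond ((n + 1) / 2) s * Nat.stirlingSecond (n / 2) (r - s) := by
  let p : Fin n → Prop := fun i => parity i = 1
  let X := {i // p i} → Fin n
  let Y := {i // ¬ p i} → Fin n
  have hXc : Fintype.card {i // p i} = (n + 1) / 2 := by
    rw [Fintype.card_subtype]; exact card_parity_eq_one n
  have hYc : Fintype.card {i // ¬ p i} = n / 2 := by
    rw [Fintype.card_subtype]; exact card_parity_ne_one n
  let T : Finset (X × Y) := univ.filter fun t =>
    (∀ y, t.2 y ∈ (univ.image t.1)ᶜ) ∧ (univ.image t.1).card + (univ.image t.2).card = r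
  -- splitting a map into its restrictions to the two classes
  have hT : {f : Function.End (Fin n) | (∀ i j, f i = f j → parity i = parity j) ∧
      rank f = r}.ncard = T.card := by
    rw [← Set.ncard_coe_finset]
    refine Set.ncard_congr
      (fun f _ => Equiv.piEquivPiSubtypeProd p (fun _ => Fin n) f) ?_ ?_ ?_
    · rintro f ⟨hk, hr⟩
      have hdis : ∀ y : {i // ¬ p i}, f y ∉ univ.image fun x : {i // p i} => f x := by
        intro y hy
        obtain ⟨x, _, hx⟩ := mem_image.1 hy
        exact y.2 ((hk _ _ hx).symm.trans x.2)
      simp only [T, coe_filter, mem_univ, true_and, Set.mem_ofPred_eq, mem_compl]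
      refine ⟨hdis, ?_⟩
      exact (rank_eq_add f hdis).symm.trans hr
    · intro f g _ _ h
      exact (Equiv.piEquivPiSubtypeProd p (fun _ => Fin n)).injective h
    · rintro ⟨g, h⟩ hgh
      obtain ⟨f, hf⟩ := (Equiv.piEquivPiSubtypeProd p (fun _ => Fin n)).surjective (g, h)
      refine ⟨f, ?_, hf⟩
      obtain ⟨rfl, rfl⟩ := Prod.mk.inj hf
      simp only [T, coe_filter, mem_univ, true_and, Set.mem_ofPred_eq, mem_compl] at hgh
      obtain ⟨hdis, hr⟩ := hgh
      refine ⟨?_, ?_⟩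
      · intro i j hij
        by_cases hi : p i <;> by_cases hj : p j
        · exact hi.trans hj.symm
        · exact absurd (mem_image.2 ⟨⟨i, hi⟩, mem_univ _, hij⟩) (hdis ⟨j, hj⟩)
        · exact absurd (mem_image.2 ⟨⟨j, hj⟩, mem_univ _, hij.symm⟩) (hdis ⟨i, hi⟩)
        · exact (parity_ne_one_iff.1 hi).trans (parity_ne_one_iff.1 hj).symm
      · exact (rank_eq_add f hdis).trans hr
  rw [hT, card_eq_sum_card_fiberwise (f := fun t => (univ.image t.1).card) (t := range (r + 1)),
    mul_sum]
  · refine sum_congr rfl fun s hs => ?_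
    have hsr : s ≤ r := Nat.lt_succ_iff.1 (mem_range.1 hs)
    have h1 : (T.filter fun t => (univ.image t.1).card = s).card =
        ∑ g ∈ univ.filter (fun g : X => (∀ x, g x ∈ (univ : Finset (Fin n))) ∧
          (univ.image g).card = s), (univ.filter fun h : Y =>
            (∀ y, h y ∈ (univ.image g)ᶜ) ∧ (univ.image h).card = r - s).card := by
      rw [filter_filter, card_filter, Fintype.sum_prod_type, sum_filter]
      refine sum_congr rfl fun g _ => ?_
      simp only [mem_univ, implies_true, true_and]
      by_cases hg : (univ.image g).card = s
      · rw [if_pos hg, card_filter]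
        refine sum_congr rfl fun h _ => if_congr ?_ rfl rfl
        rw [hg]
        constructor
        · rintro ⟨⟨h1, h2⟩, _⟩
          exact ⟨h1, by omega⟩
        · rintro ⟨h1, h2⟩
          exact ⟨⟨h1, by omega⟩, rfl⟩
      · rw [if_neg hg]
        exact sum_eq_zero fun h _ => if_neg fun hh => hg hh.2
    have h2 : ∀ g ∈ univ.filter (fun g : X => (∀ x, g x ∈ (univ : Finset (Fin n))) ∧
        (univ.image g).card = s), (univ.filter fun h : Y =>
          (∀ y, h y ∈ (univ.image g)ᶜ) ∧ (univ.image h).card = r - s).card =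
        (n - s).descFactorial (r - s) * Nat.stirlingSecond (n / 2) (r - s) := by
      intro g hg
      rw [card_filter_image_eq, hYc, card_compl, Fintype.card_fin, (mem_filter.1 hg).2.2]
    rw [h1, sum_congr rfl h2, sum_const, card_filter_image_eq, hXc, card_univ,
      Fintype.card_fin, smul_eq_mul, ← Nat.descFactorial_mul_descFactorial hsr]
    ring
  · intro t ht
    have := (mem_filter.1 (mem_coe.1 ht)).2.2
    rw [coe_range, Set.mem_Iio]
    beta_reduce
    omega

/-! ### Counting by sign -/

/-- If right translation by `τ` preserves `Q` and negates `P` on it, then exactly half of the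
permutations with `Q` satisfy `P`. -/
lemma two_mul_card_filter_of_negates (P Q : Perm (Fin n) → Prop) [DecidablePred P]
    [DecidablePred Q] (τ : Perm (Fin n)) (hQ : ∀ σ, Q (σ * τ) ↔ Q σ)
    (hP : ∀ σ, Q σ → (P (σ * τ) ↔ ¬ P σ)) :
    2 * (univ.filter fun σ => Q σ ∧ P σ).card = (univ.filter Q).card := by
  rw [← card_filter_add_card_filter_not (s := univ.filter Q) P, filter_filter, filter_filter,
    two_mul]
  congr 1
  refine card_equiv (Equiv.mulRight τ) fun σ => ?_
  simp only [mem_filter, mem_univ, true_and, Equiv.coe_mulRight, hQ]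
  constructor
  · rintro ⟨h1, h2⟩
    exact ⟨h1, fun h => (hP σ h1).1 h h2⟩
  · rintro ⟨h1, h2⟩
    exact ⟨h1, by_contra fun h => h2 ((hP σ h1).2 h)⟩

lemma neg_units_eq_iff_ne {a b : ℤˣ} : -a = b ↔ ¬ a = b := by
  rcases Int.units_eq_one_or a with rfl | rfl <;> rcases Int.units_eq_one_or b with rfl | rfl <;>
    decide

lemma two_mul_card_sign_eq_parity (hn : 3 ≤ n) (j : Fin n) :
    2 * (univ.filter fun σ : Perm (Fin n) =>
      Perm.sign σ = parity j * parity (σ j)).card = n ! := by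
  obtain ⟨x, y, hxy, hx, hy⟩ : ∃ x y : Fin n, x ≠ y ∧ x ≠ j ∧ y ≠ j := by
    have : 1 < ({j}ᶜ : Finset (Fin n)).card := by
      rw [card_compl, card_singleton, Fintype.card_fin]; omega
    obtain ⟨x, hx, y, hy, hxy⟩ := one_lt_card.1 this
    exact ⟨x, y, hxy, by simpa using hx, by simpa using hy⟩
  have h := two_mul_card_filter_of_negates
    (fun σ : Perm (Fin n) => Perm.sign σ = parity j * parity (σ j)) (fun _ => True)
    (swap x y) (fun _ => Iff.rfl) (fun σ _ => by
      rw [Perm.sign_mul, Perm.sign_swap hxy, mul_neg_one, Perm.mul_apply,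
        swap_apply_of_ne_of_ne hx.symm hy.symm, neg_units_eq_iff_ne])
  simp only [true_and, filter_true] at h
  rw [h, card_univ, Fintype.card_perm, Fintype.card_fin]

/-- An even map of rank `n - 1` is `collapse σ i j` for unique `i`, `j` of parities `1` and `-1`,
and `σ` subject to one condition on its sign, which half of the permutations satisfy. -/
lemma two_mul_ncard_SigRank (hn : 3 ≤ n) :
    2 * (SigRank n (n - 1)).ncard = (n + 1) / 2 * (n / 2) * n ! := by
  let T : Finset (Fin n × Fin n × Perm (Fin n)) := univ.filter fun t =>
    parity t.1 = 1 ∧ ¬ parity t.2.1 = 1 ∧ Perm.sign t.2.2 = parity t.2.1 * parity (t.2.2 t.2.1)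
  have hT : ∀ {i j : Fin n} {σ : Perm (Fin n)}, (i, j, σ) ∈ T ↔
      parity i = 1 ∧ ¬ parity j = 1 ∧ Perm.sign σ = parity j * parity (σ j) := by
    intro i j σ
    simp only [T, mem_filter, mem_univ, true_and]
  have hne : ∀ {i j : Fin n}, parity i = 1 → ¬ parity j = 1 → i ≠ j :=
    fun hi hj e => hj (e ▸ hi)
  have himg : SigRank n (n - 1) =
      (fun t : Fin n × Fin n × Perm (Fin n) => collapse t.2.2 t.1 t.2.1) '' (T : Set _) := by
    ext f
    constructor
    · rintro ⟨hS, hr⟩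
      obtain ⟨a, b, hab, he⟩ := exists_ne_eq_of_rank_lt (f := f) (by omega)
      obtain ⟨i, j, hi, hj, he⟩ : ∃ i j, parity i = 1 ∧ ¬ parity j = 1 ∧ f i = f j := by
        obtain ⟨σ, rfl⟩ := exists_eq_collapse hr hab he
        have hp := ((collapse_mem_Sig_iff hab).1 hS).1
        by_cases ha : parity a = 1
        · exact ⟨a, b, ha, fun hb => hp (ha.trans hb.symm), he⟩
        · refine ⟨b, a, ?_, ha, he.symm⟩
          rcases Int.units_eq_one_or (parity b) with hb | hb
          · exact hb
          · exact absurd ((parity_ne_one_iff.1 ha).trans hb.symm) hp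
      obtain ⟨σ, rfl⟩ := exists_eq_collapse hr (hne hi hj) he
      exact ⟨(i, j, σ), mem_coe.2 (hT.2 ⟨hi, hj, ((collapse_mem_Sig_iff (hne hi hj)).1 hS).2⟩), rfl⟩
    · rintro ⟨⟨i, j, σ⟩, ht, rfl⟩
      obtain ⟨hi, hj, hs⟩ := hT.1 (mem_coe.1 ht)
      exact ⟨(collapse_mem_Sig_iff (hne hi hj)).2 ⟨fun e => hj (e ▸ hi), hs⟩,
        rank_collapse σ (hne hi hj)⟩
  have hinj : Set.InjOn (fun t : Fin n × Fin n × Perm (Fin n) => collapse t.2.2 t.1 t.2.1)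
      (T : Set _) := by
    rintro ⟨i, j, σ⟩ ht ⟨i', j', σ'⟩ ht' h
    obtain ⟨hi, hj, -⟩ := hT.1 (mem_coe.1 ht)
    obtain ⟨hi', hj', -⟩ := hT.1 (mem_coe.1 ht')
    change collapse σ i j = collapse σ' i' j' at h
    have he : collapse σ' i' j' i = collapse σ' i' j' j := by
      rw [← h, collapse_left, collapse_self]
    have hij := hne hi hj
    have hij' := hne hi' hj'
    have hjj : j = j' := by
      by_contra hjj
      rw [collapse_of_ne _ _ hjj, collapse_of_ne _ _ (hne hi hj')] at he
      exact hij (σ'.injective he)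
    subst hjj
    have hii : i = i' := by
      rw [collapse_of_ne _ _ hij, collapse_self] at he
      exact σ'.injective he
    subst hii
    have hσ : σ = σ' := perm_eq_of_eq_off (j := j) fun x hx => by
      rw [← collapse_of_ne σ i hx, h, collapse_of_ne σ' i hx]
    rw [hσ]
  -- summing over `σ` first, each admissible pair `(i, j)` contributes `n ! / 2`
  have hcard : T.card = ∑ i : Fin n, ∑ j : Fin n, if parity i = 1 then if ¬ parity j = 1 then
      (univ.filter fun σ : Perm (Fin n) => Perm.sign σ = parity j * parity (σ j)).card
      else 0 else 0 := by
    rw [card_filter, Fintype.sum_prod_type]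
    refine sum_congr rfl fun i _ => ?_
    rw [Fintype.sum_prod_type]
    refine sum_congr rfl fun j _ => ?_
    by_cases hi : parity i = 1 <;> by_cases hj : parity j = 1 <;>
      simp [hi, hj]
  rw [himg, hinj.ncard_image, Set.ncard_coe_finset, hcard, mul_sum,
    ← card_parity_eq_one, ← card_parity_ne_one, mul_assoc, card_filter, sum_mul]
  refine sum_congr rfl fun i _ => ?_
  by_cases hi : parity i = 1
  · simp only [hi, if_true, one_mul]
    rw [mul_sum, card_filter, sum_mul]
    refine sum_congr rfl fun j _ => ?_
    by_cases hj : parity j = 1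
    · simp [hj]
    · simp only [hj, not_false_eq_true, if_true, one_mul]
      exact two_mul_card_sign_eq_parity hn j
  · simp [hi]

lemma card_parity_preserving (n : ℕ) :
    (univ.filter fun σ : Perm (Fin n) => ∀ j, parity (σ j) = parity j).card =
      ((n + 1) / 2)! * (n / 2)! := by
  have h := DomMulAct.stabilizer_card (parity : Fin n → ℤˣ)
  have h2 : ∏ u : ℤˣ, (Fintype.card {a : Fin n // parity a = u})! =
      (Fintype.card {a : Fin n // parity a = 1})! *
        (Fintype.card {a : Fin n // parity a = -1})! := by
    rw [show (univ : Finset ℤˣ) = {1, -1} from rfl, prod_pair (by decide)]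
  rw [h2, Fintype.card_subtype, Fintype.card_subtype, Fintype.card_subtype, card_parity_eq_one] at h
  simp only [← parity_ne_one_iff] at h
  rw [card_parity_ne_one] at h
  rw [← h]
  congr 1
  ext σ
  simp only [mem_filter, mem_univ, true_and, funext_iff, Function.comp_apply]

/-- The transposition of the points `0` and `2` preserves parity. -/
lemma two_mul_card_parity_preserving_sign (hn : 3 ≤ n) (ε : ℤˣ) :
    2 * (univ.filter fun σ : Perm (Fin n) =>
      (∀ j, parity (σ j) = parity j) ∧ Perm.sign σ = ε).card = ((n + 1) / 2)! * (n / 2)! := by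
  rw [← card_parity_preserving]
  set a : Fin n := ⟨0, by omega⟩ with ha
  set b : Fin n := ⟨2, by omega⟩ with hb
  have hab : a ≠ b := by simp [ha, hb]
  have hpar : ∀ j, parity (swap a b j) = parity j := by
    intro j
    have h0 : parity a = parity b := by simp [ha, hb, parity]
    rw [swap_apply_def]
    split_ifs with h1 h2
    · rw [h1, h0]
    · rw [h2, h0]
    · rfl
  refine two_mul_card_filter_of_negates _ _ (swap a b) (fun σ => ?_) (fun σ _ => ?_)
  · constructor
    · intro h j
      have := h (swap a b j)
      rwa [Perm.mul_apply, swap_apply_self, hpar] at this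
    · intro h j
      rw [Perm.mul_apply, h, hpar]
  · rw [Perm.sign_mul, Perm.sign_swap hab, mul_neg_one, neg_units_eq_iff_ne]

/-- An element of `Gamma n` is an even permutation that preserves parity or an odd one that reverses
it. -/
lemma ncard_Gamma_eq_add (n : ℕ) : (Gamma n).ncard =
    (univ.filter fun σ : Perm (Fin n) =>
      (∀ j, parity (σ j) = parity j) ∧ Perm.sign σ = 1).card +
    (univ.filter fun σ : Perm (Fin n) =>
      (∀ j, parity (σ j) = -parity j) ∧ Perm.sign σ = -1).card := by
  rw [← card_union_of_disjoint, ← Set.ncard_coe_finset]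
  · congr 1
    ext σ
    simp only [coe_union, coe_filter, mem_univ, true_and, Set.mem_union, Set.mem_ofPred_eq,
      mem_Gamma_iff]
    have hj : ∀ j : Fin n, ∀ ε : ℤˣ, ε = parity j * parity (σ j) ↔ parity (σ j) = ε * parity j := by
      intro j ε
      constructor
      · rintro rfl
        rw [mul_right_comm, parity_mul_self, one_mul]
      · intro h
        rw [h, mul_left_comm, parity_mul_self, mul_one]
    rcases Int.units_eq_one_or (Perm.sign σ) with h | h
    · simp only [h, hj, one_mul, and_true, show ¬ (1 : ℤˣ) = -1 by decide, and_false, or_false]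
    · simp only [h, hj, neg_mul, one_mul, and_true, show ¬ (-1 : ℤˣ) = 1 by decide, and_false,
        false_or]
  · rw [disjoint_left]
    intro σ h h'
    have h1 := (mem_filter.1 h).2.2
    rw [(mem_filter.1 h').2.2] at h1
    exact absurd h1 (by decide)

/-- For odd `n` there is one more point of parity `1` than of parity `-1`, so no permutation
reverses parity. -/
lemma two_mul_ncard_Gamma_of_odd (hn : 3 ≤ n) (ho : Odd n) :
    2 * (Gamma n).ncard = ((n + 1) / 2)! * (n / 2)! := by
  rw [ncard_Gamma_eq_add, mul_add, two_mul_card_parity_preserving_sign hn, Nat.add_eq_left,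
    mul_eq_zero, card_eq_zero, filter_eq_empty_iff]
  right
  rintro σ - ⟨hσ, -⟩
  have hle : (univ.filter fun i : Fin n => parity i = 1).card ≤
      (univ.filter fun i : Fin n => ¬ parity i = 1).card := by
    refine card_le_card_of_injOn σ (fun i hi => ?_) σ.injective.injOn
    simp only [coe_filter, mem_univ, true_and, Set.mem_ofPred_eq] at hi ⊢
    rw [hσ, hi]
    decide
  rw [card_parity_eq_one, card_parity_ne_one] at hle
  obtain ⟨k, rfl⟩ := ho
  omega

/-- For even `n` the order reversal reverses parity, so translation by it relates the two kinds of
permutations in `Gamma n`. -/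
lemma ncard_Gamma_of_even (hn : 3 ≤ n) (he : Even n) : (Gamma n).ncard = (n / 2)! ^ 2 := by
  have hrev : ∀ j : Fin n, parity (Fin.revPerm j) = -parity j := by
    intro j
    have hlt := j.2
    rw [Fin.revPerm_apply, parity, parity, Fin.val_rev]
    obtain ⟨k, hk⟩ := he
    have hodd : Odd ((n - (j + 1)) + (j : ℕ)) := ⟨k - 1, by omega⟩
    have h := hodd.neg_one_pow (α := ℤˣ)
    rw [pow_add] at h
    rw [eq_mul_inv_of_mul_eq h, Int.units_inv_eq_self, neg_one_mul]
  have hcard : (univ.filter fun σ : Perm (Fin n) =>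
      (∀ j, parity (σ j) = -parity j) ∧ Perm.sign σ = -1).card =
      (univ.filter fun σ : Perm (Fin n) => (∀ j, parity (σ j) = parity j) ∧
        Perm.sign σ = -Perm.sign (Fin.revPerm : Perm (Fin n))).card := by
    refine card_equiv (Equiv.mulRight Fin.revPerm) fun σ => ?_
    simp only [mem_filter, mem_univ, true_and, Equiv.coe_mulRight, Perm.sign_mul]
    refine and_congr ⟨fun h j => ?_, fun h j => ?_⟩ ?_
    · rw [Perm.mul_apply, h, hrev, neg_neg]
    · have := h (Fin.revPerm j)
      rwa [Perm.mul_apply, hrev, Fin.revPerm_apply, Fin.revPerm_apply, Fin.rev_rev] at this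
    · rw [← neg_one_mul (Perm.sign (Fin.revPerm : Perm (Fin n))), mul_left_inj]
  have h1 := two_mul_card_parity_preserving_sign hn 1
  have h2 := two_mul_card_parity_preserving_sign hn (-Perm.sign (Fin.revPerm : Perm (Fin n)))
  have hhalf : (n + 1) / 2 = n / 2 := by obtain ⟨k, rfl⟩ := he; omega
  rw [ncard_Gamma_eq_add, hcard, sq]
  rw [hhalf] at h1 h2
  omega

/-! ### The cardinalities -/

lemma ncard_Sig_rank_eq_self : {f | f ∈ Sig n ∧ rank f = n}.ncard = (Gamma n).ncard := by
  symm
  refine Set.ncard_congr (fun σ _ => ofPerm σ) (fun σ hσ => ?_) (fun σ τ _ _ h => ?_) ?_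
  · exact ⟨ofPerm_mem_Sig_iff.2 (mem_Gamma_iff.1 hσ), rank_eq_iff_injective.2 σ.injective⟩
  · exact Equiv.ext fun x => congrFun h x
  · rintro f ⟨hS, hr⟩
    have hinj := rank_eq_iff_injective.1 hr
    let σ : Perm (Fin n) := Equiv.ofBijective f (Finite.injective_iff_bijective.1 hinj)
    have hσ : ofPerm σ = f := rfl
    exact ⟨σ, mem_Gamma_iff.2 (ofPerm_mem_Sig_iff.1 (hσ ▸ hS)), hσ⟩

/-- All maps of rank less than `n - 1` lie in `Sig n`, and the numbers of maps of rank `n` and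
`n - 1` are `n !` and `n.choose 2 * n !`. -/
lemma ncard_Sig_add (hn : 3 ≤ n) :
    (Sig n).ncard + (1 + n.choose 2) * n ! =
      n ^ n + (Gamma n).ncard + (SigRank n (n - 1)).ncard := by
  obtain ⟨m, rfl⟩ : ∃ m, n = m + 1 := ⟨n - 1, by omega⟩
  have hS := ncard_eq_sum_rank (Sig (m + 1)) (range (m + 2)) fun f _ =>
    mem_range.2 (Nat.lt_succ_of_le (rank_le f))
  have hU := ncard_eq_sum_rank (Set.univ : Set (Function.End (Fin (m + 1)))) (range (m + 2))
    fun f _ => mem_range.2 (Nat.lt_succ_of_le (rank_le f))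
  rw [sum_range_succ, sum_range_succ] at hS hU
  have hlow : ∑ r ∈ range m, {f | f ∈ Sig (m + 1) ∧ rank f = r}.ncard =
      ∑ r ∈ range m, {f : Function.End (Fin (m + 1)) | f ∈ Set.univ ∧ rank f = r}.ncard := by
    refine sum_congr rfl fun r hr => congrArg _ (Set.ext fun f => ?_)
    refine and_congr_left fun h => iff_of_true (mem_Sig_of_rank_lt ?_) trivial
    have := mem_range.1 hr
    omega
  simp only [Set.mem_univ, true_and] at hU hlow
  rw [hlow, ncard_Sig_rank_eq_self] at hS
  rw [ncard_rank_eq _ (m + 1), ncard_rank_eq _ m, Nat.stirlingSecond_self,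
    Nat.stirlingSecond_succ_self_left, Nat.descFactorial_self, Set.ncard_univ] at hU
  have hfun : Nat.card (Function.End (Fin (m + 1))) = (m + 1) ^ (m + 1) := by
    change Nat.card (Fin (m + 1) → Fin (m + 1)) = _
    simp
  have hdesc : (m + 1).descFactorial m = (m + 1)! := by
    have := Nat.factorial_mul_descFactorial (Nat.le_succ m)
    simpa using this
  rw [hfun, hdesc] at hU
  have hR : (SigRank (m + 1) (m + 1 - 1)).ncard = {f | f ∈ Sig (m + 1) ∧ rank f = m}.ncard := rfl
  rw [hR, hS, hU]
  ring

/-- The term `s = 0` vanishes because the first class is not empty. -/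
lemma sum_stirling_eq {a : ℕ} (ha : 0 < a) (b r : ℕ) :
    ∑ s ∈ Icc 1 a, stirling a (s : ℤ) * stirling b ((r : ℤ) - (s : ℤ)) =
      ∑ s ∈ range (r + 1), Nat.stirlingSecond a s * Nat.stirlingSecond b (r - s) := by
  have hst : ∀ s : ℕ, stirling a (s : ℤ) = Nat.stirlingSecond a s := fun s => by simp [stirling]
  have hst' : ∀ s : ℕ, s ≤ r → stirling b ((r : ℤ) - (s : ℤ)) = Nat.stirlingSecond b (r - s) := by
    intro s hs
    rw [← Int.ofNat_sub hs, stirling, if_pos (Int.natCast_nonneg _), Int.toNat_natCast]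
  have hst0 : ∀ s : ℕ, r < s → stirling b ((r : ℤ) - (s : ℤ)) = 0 := by
    intro s hs
    rw [stirling, if_neg (by omega)]
  obtain ⟨a, rfl⟩ : ∃ a', a = a' + 1 := ⟨a - 1, by omega⟩
  have h1 : ∑ s ∈ Icc 1 (a + 1), stirling (a + 1) (s : ℤ) * stirling b ((r : ℤ) - (s : ℤ)) =
      ∑ s ∈ range (r + 1) ∩ Icc 1 (a + 1),
        Nat.stirlingSecond (a + 1) s * Nat.stirlingSecond b (r - s) := by
    rw [← sum_subset (inter_subset_right (s₁ := range (r + 1)))]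
    · refine sum_congr rfl fun s hs => ?_
      have := mem_range.1 (mem_inter.1 hs).1
      rw [hst, hst' s (by omega)]
    · intro s hs hs'
      have : r < s := by
        by_contra h
        exact hs' (mem_inter.2 ⟨mem_range.2 (by omega), hs⟩)
      rw [hst0 s this, mul_zero]
  rw [h1]
  refine sum_subset inter_subset_left fun s hs hs' => ?_
  rcases Nat.eq_zero_or_pos s with rfl | h0
  · rw [Nat.stirlingSecond_succ_zero, zero_mul]
  · have : a + 1 < s := by
      by_contra h
      exact hs' (mem_inter.2 ⟨hs, mem_Icc.2 ⟨h0, by omega⟩⟩)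
    rw [Nat.stirlingSecond_eq_zero_of_lt this, zero_mul]

lemma ncard_Sig_sdiff_Delta (hn : 3 ≤ n) :
    (Sig n \ (Delta n : Set (Function.End (Fin n)))).ncard =
      ∑ r ∈ Icc 1 (n - 2), n.choose r * r ! *
        ∑ s ∈ Icc 1 ((n + 1) / 2), stirling ((n + 1) / 2) (s : ℤ) *
          stirling (n / 2) ((r : ℤ) - (s : ℤ)) := by
  rw [ncard_eq_sum_rank _ (Icc 1 (n - 2))]
  · refine sum_congr rfl fun r hr => ?_
    rw [sum_stirling_eq (by omega), mul_comm (n.choose r),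
      ← Nat.descFactorial_eq_factorial_mul_choose,
      ← ncard_ker_le_parity_rank_eq]
    congr 1
    ext f
    have := mem_Icc.1 hr
    change f ∈ Sig n \ _ ∧ rank f = r ↔ _ ∧ rank f = r
    refine and_congr_left fun h => ?_
    rw [mem_Sig_sdiff_Delta_iff hn]
    exact and_iff_right (by omega)
  · intro f hf
    have hr := ((mem_Sig_sdiff_Delta_iff hn).1 hf).1
    have hpos : 0 < rank f := by
      refine (card_pos.2 ?_).trans_eq (rank_eq_card_image f).symm
      exact ⟨_, mem_image_of_mem _ (mem_univ ⟨0, by omega⟩)⟩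
    exact mem_Icc.2 ⟨hpos, by omega⟩

end EvenTransf

theorem mainTheorem6 (n : ℕ) (hn : 3 ≤ n) :
    -- the size of `Σ_n` through those of `Γ_n` and `Σ_n(r = n - 1)`
    (((EvenTransf.Sig n).ncard : ℚ) =
      (n : ℚ) ^ n - (1 + (n.choose 2 : ℚ)) * (n ! : ℚ)
        + ((EvenTransf.Gamma n).ncard : ℚ) + ((EvenTransf.SigRank n (n - 1)).ncard : ℚ)) ∧
    -- closed forms, `n` odd
    (Odd n →
      ((EvenTransf.Gamma n).ncard : ℚ) =
        1 / 2 * (((n - 1) / 2)! : ℚ) * (((n + 1) / 2)! : ℚ) ∧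
      ((EvenTransf.SigRank n (n - 1)).ncard : ℚ) =
        (n ! : ℚ) * ((n : ℚ) - 1) * ((n : ℚ) + 1) / 8 ∧
      ((EvenTransf.Sig n).ncard : ℚ) =
        (n : ℚ) ^ n - (1 + (n.choose 2 : ℚ)) * (n ! : ℚ)
          + 1 / 2 * (((n - 1) / 2)! : ℚ) * (((n + 1) / 2)! : ℚ)
          + (n ! : ℚ) * ((n : ℚ) - 1) * ((n : ℚ) + 1) / 8 ∧
      (EvenTransf.Sig n \ (EvenTransf.Delta n : Set (Function.End (Fin n)))).ncard =
        ∑ r ∈ Finset.Icc 1 (n - 2), n.choose r * r ! *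
          ∑ s ∈ Finset.Icc 1 ((n + 1) / 2),
            EvenTransf.stirling ((n + 1) / 2) (s : ℤ) *
              EvenTransf.stirling ((n - 1) / 2) ((r : ℤ) - (s : ℤ)) ∧
      ((EvenTransf.Delta n : Set (Function.End (Fin n))).ncard : ℚ) =
        (n : ℚ) ^ n - (1 + (n.choose 2 : ℚ)) * (n ! : ℚ)
          + 1 / 2 * (((n - 1) / 2)! : ℚ) * (((n + 1) / 2)! : ℚ)
          + (n ! : ℚ) * ((n : ℚ) - 1) * ((n : ℚ) + 1) / 8
          - ((∑ r ∈ Finset.Icc 1 (n - 2), n.choose r * r ! *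
              ∑ s ∈ Finset.Icc 1 ((n + 1) / 2),
                EvenTransf.stirling ((n + 1) / 2) (s : ℤ) *
                  EvenTransf.stirling ((n - 1) / 2) ((r : ℤ) - (s : ℤ)) : ℕ) : ℚ)) ∧
    -- closed forms, `n` even
    (Even n →
      ((EvenTransf.Gamma n).ncard : ℚ) = ((n / 2)! : ℚ) ^ 2 ∧
      ((EvenTransf.SigRank n (n - 1)).ncard : ℚ) = (n ! : ℚ) * (n : ℚ) ^ 2 / 8 ∧
      ((EvenTransf.Sig n).ncard : ℚ) =
        (n : ℚ) ^ n - (1 + (n.choose 2 : ℚ)) * (n ! : ℚ)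
          + ((n / 2)! : ℚ) ^ 2 + (n ! : ℚ) * (n : ℚ) ^ 2 / 8 ∧
      (EvenTransf.Sig n \ (EvenTransf.Delta n : Set (Function.End (Fin n)))).ncard =
        ∑ r ∈ Finset.Icc 1 (n - 2), n.choose r * r ! *
          ∑ s ∈ Finset.Icc 1 (n / 2),
            EvenTransf.stirling (n / 2) (s : ℤ) *
              EvenTransf.stirling (n / 2) ((r : ℤ) - (s : ℤ)) ∧
      ((EvenTransf.Delta n : Set (Function.End (Fin n))).ncard : ℚ) =
        (n : ℚ) ^ n - (1 + (n.choose 2 : ℚ)) * (n ! : ℚ)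
          + ((n / 2)! : ℚ) ^ 2 + (n ! : ℚ) * (n : ℚ) ^ 2 / 8
          - ((∑ r ∈ Finset.Icc 1 (n - 2), n.choose r * r ! *
              ∑ s ∈ Finset.Icc 1 (n / 2),
                EvenTransf.stirling (n / 2) (s : ℤ) *
                  EvenTransf.stirling (n / 2) ((r : ℤ) - (s : ℤ)) : ℕ) : ℚ)) ∧
    -- the relation between the sizes of `Δ_n` and `Σ_n`
    ((EvenTransf.Delta n : Set (Function.End (Fin n))).ncard : ℚ) =
      ((EvenTransf.Sig n).ncard : ℚ) -
        ((EvenTransf.Sig n \ (EvenTransf.Delta n : Set (Function.End (Fin n)))).ncard : ℚ) := by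
  have hSig : ((EvenTransf.Sig n).ncard : ℚ) =
      (n : ℚ) ^ n - (1 + (n.choose 2 : ℚ)) * (n ! : ℚ)
        + ((EvenTransf.Gamma n).ncard : ℚ) + ((EvenTransf.SigRank n (n - 1)).ncard : ℚ) := by
    have h : (((EvenTransf.Sig n).ncard + (1 + n.choose 2) * n ! : ℕ) : ℚ) =
        ((n ^ n + (EvenTransf.Gamma n).ncard + (EvenTransf.SigRank n (n - 1)).ncard : ℕ) : ℚ) :=
      congrArg _ (EvenTransf.ncard_Sig_add hn)
    push_cast at h
    linarith
  have hDelta : ((EvenTransf.Delta n : Set (Function.End (Fin n))).ncard : ℚ) =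
      ((EvenTransf.Sig n).ncard : ℚ) -
        ((EvenTransf.Sig n \ (EvenTransf.Delta n : Set (Function.End (Fin n)))).ncard : ℚ) := by
    have : Finite (Function.End (Fin n)) := inferInstanceAs (Finite (Fin n → Fin n))
    rw [← Set.ncard_sdiff_add_ncard_of_subset (EvenTransf.Delta_subset_Sig (n := n))]
    push_cast
    ring
  have hrank : (2 : ℚ) * (EvenTransf.SigRank n (n - 1)).ncard =
      (((n + 1) / 2 : ℕ) : ℚ) * ((n / 2 : ℕ) : ℚ) * (n ! : ℚ) := by
    exact_mod_cast EvenTransf.two_mul_ncard_SigRank hn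
  have hdiff := EvenTransf.ncard_Sig_sdiff_Delta hn
  refine ⟨hSig, fun ho => ?_, fun he => ?_, hDelta⟩
  · have hhalf : (n - 1) / 2 = n / 2 := by obtain ⟨k, rfl⟩ := ho; omega
    rw [hhalf]
    have hG : ((EvenTransf.Gamma n).ncard : ℚ) =
        1 / 2 * ((n / 2)! : ℚ) * (((n + 1) / 2)! : ℚ) := by
      have h : (2 : ℚ) * (EvenTransf.Gamma n).ncard = (((n + 1) / 2)! : ℚ) * ((n / 2)! : ℚ) := by
        exact_mod_cast EvenTransf.two_mul_ncard_Gamma_of_odd hn ho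
      linarith
    have hR : ((EvenTransf.SigRank n (n - 1)).ncard : ℚ) =
        (n ! : ℚ) * ((n : ℚ) - 1) * ((n : ℚ) + 1) / 8 := by
      obtain ⟨k, hk⟩ := ho
      rw [show (n + 1) / 2 = k + 1 by omega, show n / 2 = k by omega] at hrank
      have hkq : (n : ℚ) = 2 * k + 1 := by rw [hk]; push_cast; ring
      rw [hkq]
      push_cast at hrank
      linear_combination hrank / 2
    refine ⟨hG, hR, ?_, hdiff, ?_⟩
    · rw [hSig, hG, hR]
    · rw [hDelta, hdiff, hSig, hG, hR]
  · have hhalf : (n + 1) / 2 = n / 2 := by obtain ⟨k, rfl⟩ := he; omega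
    rw [hhalf] at hdiff
    have hG : ((EvenTransf.Gamma n).ncard : ℚ) = ((n / 2)! : ℚ) ^ 2 := by
      exact_mod_cast EvenTransf.ncard_Gamma_of_even hn he
    have hR : ((EvenTransf.SigRank n (n - 1)).ncard : ℚ) = (n ! : ℚ) * (n : ℚ) ^ 2 / 8 := by
      obtain ⟨k, hk⟩ := he
      rw [show (n + 1) / 2 = k by omega, show n / 2 = k by omega] at hrank
      have hkq : (n : ℚ) = 2 * k := by rw [hk]; push_cast; ring
      rw [hkq]
      linear_combination hrank / 2
    refine ⟨hG, hR, ?_, hdiff, ?_⟩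
    · rw [hSig, hG, hR]
    · rw [hDelta, hdiff, hSig, hG, hR]
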